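/- **Theorem 3.2.** Let $k$ be an algebraically closed field of characteristic $0$, and let $p\in k[X,Y]$ be an irreducible polynomial with $p\notin k[X]$ and $p\notin k[Y]$. Let $C\subset\mathbb P^1\times\mathbb P^1$ be the curve defined by the bi-homogenization $x_0^{\deg_x p}\,y_0^{\deg_y p}\,p(x_1/x_0,\,y_1/y_0)$. Regard $C$ as a binary relation between two copies of $\mathbb P^1$, and write ${}^{\mathrm{tr}}C$ for its transpose, so that ${}^{\mathrm{tr}}C\circ C$ relates $z$ to $w$ if and only if there is a $y\in\mathbb P^1$ with $(z,y)\in C$ and $(w,y)\in C$. Let $({}^{\mathrm{tr}}C\circ C)^{(n)}$ be its $n$-fold iterate. The correspondence is called finite if $({}^{\mathrm{tr}}C\circ C)^{(n)}=({}^{\mathrm{tr}}C\circ C)^{(n+1)}$ for some integer $n\ge 1$, and infinite otherwise. An orbit is an equivalence class of the smallest equivalence relation on the points of $C$ under which $(z_1,z_2)$ and $(w_1,w_2)$ are equivalent whenever $z_1=w_1$ or $z_2=w_2$. If the curve $C$ is normal and the correspondence is infinite, then only finitely many of its orbits are finite sets. Moreover, their number is bounded by a function of the degree of $p$ alone: there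 is a function $B:\mathbb N\to\mathbb N$, independent of $k$ and $p$, such that for all such $k$ and $p$ the number of finite orbits is at most $B(\deg p)$, where $\deg p$ is the total degree. -/

import Mathlib

open scoped LinearAlgebra.Projectivization

noncomputable section

namespace PlaneCorrespondence

variable {k : Type*} [Field k]

/-- The projective line over `k`. A point `[v 0 : v 1]` is the class of a non-zero vector `v`;
the affine coordinate is `v 1 / v 0`. -/
abbrev P1 (k : Type*) [Field k] : Type _ := ℙ k (Fin 2 → k)

/-- The bi-homogenization `x₀ ^ deg_x p * y₀ ^ deg_y p * p (x₁ / x₀, y₁ / y₀)` of `p (X, Y)`, where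
`X 0, X 1` stand for `X, Y`. The variable `X (0, j)` is `x_j` and the variable `X (1, j)` is
`y_j`. -/
def biHomogenization (p : MvPolynomial (Fin 2) k) : MvPolynomial (Fin 2 × Fin 2) k :=
  ∑ m ∈ p.support, MvPolynomial.C (p.coeff m) *
    ∏ i : Fin 2, (MvPolynomial.X (i, 0) ^ (p.degreeOf i - m i) * MvPolynomial.X (i, 1) ^ m i)

/-- The value of the bi-homogenization of `p` at `x = v` and `y = w`. -/
def biEval (p : MvPolynomial (Fin 2) k) (v w : Fin 2 → k) : k :=
  MvPolynomial.eval (fun ij => if ij.1 = 0 then v ij.2 else w ij.2) (biHomogenization p)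

/-- The curve `C` in `ℙ¹ × ℙ¹`, that is, the zero set of the bi-homogenization of `p`, viewed as a
binary relation between two projective lines. The choice of the representatives is irrelevant, see
`mem_curve_mk`. -/
def curve (p : MvPolynomial (Fin 2) k) : SetRel (P1 k) (P1 k) :=
  {P | biEval p P.1.rep P.2.rep = 0}

lemma biEval_eq (p : MvPolynomial (Fin 2) k) (v w : Fin 2 → k) :
    biEval p v w = ∑ m ∈ p.support, p.coeff m *
      ((v 0 ^ (p.degreeOf 0 - m 0) * v 1 ^ m 0) * (w 0 ^ (p.degreeOf 1 - m 1) * w 1 ^ m 1)) := by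
  simp [biEval, biHomogenization, Fin.prod_univ_two]

lemma biEval_smul (p : MvPolynomial (Fin 2) k) (s t : k) (v w : Fin 2 → k) :
    biEval p (s • v) (t • w) = s ^ p.degreeOf 0 * t ^ p.degreeOf 1 * biEval p v w := by
  rw [biEval_eq, biEval_eq, Finset.mul_sum]
  refine Finset.sum_congr rfl fun m hm => ?_
  have h0 := MvPolynomial.degreeOf_le_iff.1 (le_refl (p.degreeOf 0)) m hm
  have h1 := MvPolynomial.degreeOf_le_iff.1 (le_refl (p.degreeOf 1)) m hm
  have e0 : s ^ p.degreeOf 0 = s ^ (p.degreeOf 0 - m 0) * s ^ m 0 := by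
    rw [← pow_add, Nat.sub_add_cancel h0]
  have e1 : t ^ p.degreeOf 1 = t ^ (p.degreeOf 1 - m 1) * t ^ m 1 := by
    rw [← pow_add, Nat.sub_add_cancel h1]
  rw [e0, e1]
  simp only [Pi.smul_apply, smul_eq_mul, mul_pow]
  ring

/-- Membership in the curve may be tested on any homogeneous coordinates. -/
lemma mem_curve_mk (p : MvPolynomial (Fin 2) k) (v w : Fin 2 → k) (hv : v ≠ 0) (hw : w ≠ 0) :
    (Projectivization.mk k v hv, Projectivization.mk k w hw) ∈ curve p ↔ biEval p v w = 0 := by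
  obtain ⟨s, hs⟩ := Projectivization.exists_smul_eq_mk_rep k v hv
  obtain ⟨t, ht⟩ := Projectivization.exists_smul_eq_mk_rep k w hw
  have h : biEval p (Projectivization.mk k v hv).rep (Projectivization.mk k w hw).rep =
      (s : k) ^ p.degreeOf 0 * (t : k) ^ p.degreeOf 1 * biEval p v w := by
    rw [← hs, ← ht]
    exact biEval_smul p s t v w
  change biEval p _ _ = 0 ↔ _
  rw [h]
  simp

/-- On the affine chart `x₀ = y₀ = 1` the curve is the zero set of `p`. -/
lemma biEval_affine (p : MvPolynomial (Fin 2) k) (a b : k) :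
    biEval p ![1, a] ![1, b] = MvPolynomial.eval ![a, b] p := by
  rw [biEval_eq, MvPolynomial.eval_eq']
  simp [Fin.prod_univ_two]

/-- The equation of the curve in the affine chart of `ℙ¹ × ℙ¹` where `x_{a 0} = 1` and
`y_{a 1} = 1`: the bi-homogenization of `p` with these variables set to `1`, the other homogeneous
coordinate of each line being the affine coordinate. -/
def chartPoly (p : MvPolynomial (Fin 2) k) (a : Fin 2 → Fin 2) : MvPolynomial (Fin 2) k :=
  MvPolynomial.aeval
    (fun ij : Fin 2 × Fin 2 =>
      if ij.2 = a ij.1 then (1 : MvPolynomial (Fin 2) k) else MvPolynomial.X ij.1)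
    (biHomogenization p)

/-- In the chart `x₀ = y₀ = 1` the equation is `p` itself. -/
lemma chartPoly_zero (p : MvPolynomial (Fin 2) k) : chartPoly p 0 = p := by
  conv_rhs => rw [p.as_sum]
  simp only [chartPoly, biHomogenization, map_sum, map_mul, map_prod, map_pow,
    MvPolynomial.aeval_X, MvPolynomial.aeval_C, Pi.zero_apply]
  refine Finset.sum_congr rfl fun m _ => ?_
  rw [MvPolynomial.monomial_eq, Finsupp.prod_fintype _ _ (by simp)]
  simp [MvPolynomial.algebraMap_eq]

/-- The coordinate ring of the curve in an affine chart of `ℙ¹ × ℙ¹`. -/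
abbrev ChartRing (p : MvPolynomial (Fin 2) k) (a : Fin 2 → Fin 2) : Type _ :=
  MvPolynomial (Fin 2) k ⧸ Ideal.span {chartPoly p a}

/-- The curve is normal: its coordinate rings in the four affine charts that cover `ℙ¹ × ℙ¹` are
integrally closed in their fields of fractions (equivalently, for irreducible `p`, all of its local
rings are). -/
def IsNormalCurve (p : MvPolynomial (Fin 2) k) : Prop :=
  ∀ a : Fin 2 → Fin 2, IsIntegrallyClosed (ChartRing p a)

/-- The `n`-fold iterate `R^(n)` of a binary relation `R` on a set. -/
def iter {α : Type*} (R : SetRel α α) : ℕ → SetRel α α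
  | 0 => SetRel.id
  | n + 1 => (iter R n).comp R

/-- The composite `ᵗʳC ∘ C` (first `C`, then its transpose): `z` is related to `w` if there is a
`y` with `(z, y) ∈ C` and `(w, y) ∈ C`. -/
def roundTrip (p : MvPolynomial (Fin 2) k) : SetRel (P1 k) (P1 k) :=
  (curve p).comp (curve p).inv

/-- The correspondence is finite: `(ᵗʳC ∘ C)^(n) = (ᵗʳC ∘ C)^(n+1)` for some positive `n`. -/
def IsFiniteCorrespondence (p : MvPolynomial (Fin 2) k) : Prop :=
  ∃ n : ℕ, 0 < n ∧ iter (roundTrip p) n = iter (roundTrip p) (n + 1)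

/-- The smallest equivalence relation on the points of `C` for which points with the same first or
the same second coordinate are equivalent. -/
def orbitSetoid (p : MvPolynomial (Fin 2) k) : Setoid (curve p) :=
  Relation.EqvGen.setoid fun z w => z.1.1 = w.1.1 ∨ z.1.2 = w.1.2

/-- The set of those orbits (equivalence classes) that are finite sets. -/
def finiteOrbits (p : MvPolynomial (Fin 2) k) : Set (Set (curve p)) :=
  {O | O ∈ (orbitSetoid p).classes ∧ O.Finite}

end PlaneCorrespondence

end

/-!
Call a value of one of the two coordinates exceptional if it is infinite or a zero of the resultant
of `p` and its derivative in the other variable. By the degree of the resultant, the number of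
exceptional values, hence of orbits meeting them, is bounded in terms of the degree of `p`. A finite
orbit without exceptional values is affine and unramified: the affine coordinates of its points form
finite sets `A 0` and `A 1` whose preimages on the curve are the same reduced divisor.

Two such orbits would give disjoint pairs `A` and `B`. Replace each finite set by the polynomial
with simple roots at its points. For `α * |A i| = β * |B i|` the rational functions
`(A 0) ^ α / (B 0) ^ β` and `(A 1) ^ α / (B 1) ^ β` then have the same zeros and poles on the curve.
Their ratio lies in every valuation ring of the function field over `k`, since this ring provides
unimodular homogeneous coordinates and the roots of `A i` and `B i` can be compared one linear
factor at a time; so the ratio is a constant. Hence a map `ℙ¹ → ℙ¹` with fibres of bounded size is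
constant along round trips, the iterates of the round trip relation stabilize, and the
correspondence is finite. So in an infinite correspondence at most one finite orbit avoids the
exceptional values.
-/

open scoped LinearAlgebra.Projectivization

noncomputable section

namespace PlaneCorrespondence

section HomogeneousEvaluation

lemma degreeOf_toMvPolynomial_le {σ k : Type*} [DecidableEq σ] [CommSemiring k] [Nontrivial k]
    {f : Polynomial k} {n : ℕ}
    (hf : f.natDegree ≤ n) (i l : σ) :
    (f.toMvPolynomial i).degreeOf l ≤ Pi.single (M := fun _ => ℕ) i n l := by
  rw [f.as_sum_range_C_mul_X_pow, map_sum]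
  refine (MvPolynomial.degreeOf_sum_le _ _ _).trans (Finset.sup_le fun m hm => ?_)
  rw [map_mul, map_pow, Polynomial.toMvPolynomial_C, Polynomial.toMvPolynomial_X]
  refine (MvPolynomial.degreeOf_C_mul_le _ _ _).trans ?_
  have hmn : m ≤ n := (Finset.mem_range_succ_iff.1 hm).trans hf
  rcases eq_or_ne l i with rfl | hli
  · rw [Pi.single_eq_same]
    refine (MvPolynomial.degreeOf_pow_le _ _ _).trans ?_
    simpa using hmn
  · simp [hli, MvPolynomial.X_pow_eq_monomial, MvPolynomial.degreeOf_monomial_eq]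

variable {σ k R S : Type*} [Fintype σ] [CommRing k] [CommRing R] [Algebra k R] [CommRing S]
  [Algebra k S]

/-- The value at homogeneous coordinates `t` of the multihomogenization of a polynomial in degrees
`d`. As in `biHomogenization`, the affine coordinates are `t i 1 / t i 0`. Truncated subtraction
makes the value meaningless on a polynomial whose degree in the variable `i` exceeds `d i`. -/
def homEval (d : σ → ℕ) (t : σ → Fin 2 → R) : MvPolynomial σ k →ₗ[k] R :=
  (MvPolynomial.basisMonomials σ k).constr k fun m => ∏ i, t i 0 ^ (d i - m i) * t i 1 ^ m i

lemma homEval_monomial (d : σ → ℕ) (t : σ → Fin 2 → R) (m : σ →₀ ℕ) (c : k) :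
    homEval d t (MvPolynomial.monomial m c) = c • ∏ i, t i 0 ^ (d i - m i) * t i 1 ^ m i := by
  have h : MvPolynomial.monomial m c = c • MvPolynomial.basisMonomials σ k m := by
    simp [MvPolynomial.smul_monomial]
  rw [h, map_smul, homEval, Module.Basis.constr_basis]

lemma homEval_eq_sum (d : σ → ℕ) (t : σ → Fin 2 → R) (p : MvPolynomial σ k) :
    homEval d t p = ∑ m ∈ p.support, p.coeff m • ∏ i, t i 0 ^ (d i - m i) * t i 1 ^ m i := by
  conv_lhs => rw [p.as_sum, map_sum]
  simp only [homEval_monomial]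

lemma map_homEval (φ : R →ₐ[k] S) (d : σ → ℕ) (t : σ → Fin 2 → R) (p : MvPolynomial σ k) :
    φ (homEval d t p) = homEval d (fun i => φ ∘ t i) p := by
  simp [homEval_eq_sum]

lemma homEval_smul_affine (s x : σ → R) {d : σ → ℕ} {p : MvPolynomial σ k}
    (hd : ∀ i, p.degreeOf i ≤ d i) :
    homEval d (fun i => s i • ![1, x i]) p = (∏ i, s i ^ d i) * MvPolynomial.aeval x p := by
  rw [homEval_eq_sum, MvPolynomial.aeval_def, MvPolynomial.eval₂_eq', Finset.mul_sum]
  refine Finset.sum_congr rfl fun m hm => ?_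
  have hs : ∀ i, s i ^ d i = s i ^ (d i - m i) * s i ^ m i := fun i => by
    rw [← pow_add, Nat.sub_add_cancel (MvPolynomial.degreeOf_le_iff.1 (hd i) m hm)]
  simp only [hs, Finset.prod_mul_distrib, mul_pow, Pi.smul_apply, smul_eq_mul,
    Matrix.cons_val_zero, Matrix.cons_val_one, mul_one]
  rw [Algebra.smul_def]
  ring

lemma homEval_mul (t : σ → Fin 2 → R) {d e : σ → ℕ} {p q : MvPolynomial σ k}
    (hp : ∀ i, p.degreeOf i ≤ d i) (hq : ∀ i, q.degreeOf i ≤ e i) :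
    homEval (d + e) t (p * q) = homEval d t p * homEval e t q := by
  conv_lhs => rw [p.as_sum, q.as_sum]
  simp only [homEval_eq_sum d, homEval_eq_sum e, Finset.sum_mul_sum, map_sum,
    MvPolynomial.monomial_mul, homEval_monomial]
  refine Finset.sum_congr rfl fun m hm => Finset.sum_congr rfl fun n hn => ?_
  rw [smul_mul_smul_comm, ← Finset.prod_mul_distrib]
  congr 1
  refine Finset.prod_congr rfl fun i _ => ?_
  have hm := MvPolynomial.degreeOf_le_iff.1 (hp i) m hm
  have hn := MvPolynomial.degreeOf_le_iff.1 (hq i) n hn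
  rw [Pi.add_apply, Finsupp.add_apply, ← tsub_add_tsub_comm hm hn, pow_add, pow_add]
  ring

lemma homEval_eq_zero_of_dvd [NoZeroDivisors k] {t : σ → Fin 2 → R} {d : σ → ℕ}
    {p q : MvPolynomial σ k} (hpq : p ∣ q) (hd : ∀ i, q.degreeOf i ≤ d i)
    (hp : homEval (fun i => p.degreeOf i) t p = 0) : homEval d t q = 0 := by
  obtain ⟨r, rfl⟩ := hpq
  by_cases hpr : p * r = 0
  · rw [hpr, map_zero]
  have hdeg : ∀ i, p.degreeOf i + r.degreeOf i ≤ d i := fun i => by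
    rw [← MvPolynomial.degreeOf_mul_eq (left_ne_zero_of_mul hpr) (right_ne_zero_of_mul hpr)]
    exact hd i
  have hsplit : d = (fun i => p.degreeOf i) + (fun i => d i - p.degreeOf i) :=
    funext fun i => (Nat.add_sub_cancel' (le_of_add_le_left (hdeg i))).symm
  rw [hsplit, homEval_mul t (fun _ => le_rfl) fun i => Nat.le_sub_of_add_le' (hdeg i), hp,
    zero_mul]

lemma homEval_one (t : σ → Fin 2 → R) : homEval 0 t (1 : MvPolynomial σ k) = 1 := by
  simpa using homEval_monomial 0 t (0 : σ →₀ ℕ) (1 : k)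

lemma homEval_pow (t : σ → Fin 2 → R) {d : σ → ℕ} {p : MvPolynomial σ k}
    (hp : ∀ i, p.degreeOf i ≤ d i) (n : ℕ) : homEval (n • d) t (p ^ n) = homEval d t p ^ n := by
  induction n with
  | zero => simp only [zero_smul, pow_zero, homEval_one]
  | succ n ih =>
    have hpn : ∀ i, (p ^ n).degreeOf i ≤ (n • d) i := fun i =>
      (MvPolynomial.degreeOf_pow_le i p n).trans (Nat.mul_le_mul_left n (hp i))
    rw [succ_nsmul, pow_succ, homEval_mul t hpn hp, ih, pow_succ]

variable [DecidableEq σ]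

lemma homEval_toMvPolynomial (t : σ → Fin 2 → R) (i : σ) {f : Polynomial k} {n : ℕ}
    (hf : f.natDegree ≤ n) :
    homEval (Pi.single i n) t (f.toMvPolynomial i) =
      ∑ m ∈ Finset.range (n + 1), f.coeff m • (t i 0 ^ (n - m) * t i 1 ^ m) := by
  conv_lhs => rw [f.as_sum_range' (n + 1) (Nat.lt_succ_of_le hf), map_sum, map_sum]
  refine Finset.sum_congr rfl fun m _ => ?_
  have hmonomial : (Polynomial.monomial m (f.coeff m)).toMvPolynomial i =
      MvPolynomial.monomial (Finsupp.single i m) (f.coeff m) := by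
    rw [← Polynomial.C_mul_X_pow_eq_monomial, map_mul, map_pow, Polynomial.toMvPolynomial_C,
      Polynomial.toMvPolynomial_X, MvPolynomial.C_mul_X_pow_eq_monomial]
  rw [hmonomial, homEval_monomial, Finset.prod_eq_single i (fun l _ hl => by simp [hl])
    (fun h => absurd (Finset.mem_univ i) h)]
  simp

lemma homEval_toMvPolynomial_mul [Nontrivial k] (t : σ → Fin 2 → R) (i : σ)
    {f g : Polynomial k} {m n : ℕ} (hf : f.natDegree ≤ m) (hg : g.natDegree ≤ n) :
    homEval (Pi.single i (m + n)) t ((f * g).toMvPolynomial i) =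
      homEval (Pi.single i m) t (f.toMvPolynomial i) *
        homEval (Pi.single i n) t (g.toMvPolynomial i) := by
  rw [map_mul, Pi.single_add, homEval_mul t (degreeOf_toMvPolynomial_le hf i)
    (degreeOf_toMvPolynomial_le hg i)]

/-- The monic polynomial with simple roots at the points of a finite set. -/
def rootPoly (A : Finset k) : Polynomial k := ∏ a ∈ A, (Polynomial.X - Polynomial.C a)

/-- The homogenization of `rootPoly A`, evaluated at homogeneous coordinates `u`. -/
def rootForm (A : Finset k) (u : Fin 2 → R) : R := ∏ a ∈ A, (u 1 - algebraMap k R a * u 0)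

lemma map_rootForm (φ : R →ₐ[k] S) (A : Finset k) (u : Fin 2 → R) :
    φ (rootForm A u) = rootForm A (φ ∘ u) := by
  simp [rootForm]

lemma natDegree_rootPoly [Nontrivial k] (A : Finset k) : (rootPoly A).natDegree = A.card :=
  Polynomial.natDegree_finsetProd_X_sub_C_eq_card A id

lemma homEval_rootPoly [Nontrivial k] (t : σ → Fin 2 → R) (i : σ) (A : Finset k) :
    homEval (Pi.single i A.card) t ((rootPoly A).toMvPolynomial i) = rootForm A (t i) := by
  classical
  induction A using Finset.induction_on with
  | empty => simp [rootPoly, rootForm, homEval_one]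
  | insert a A ha ih =>
    have hlinear : homEval (Pi.single i 1) t ((Polynomial.X - Polynomial.C a).toMvPolynomial i) =
        t i 1 - algebraMap k R a * t i 0 := by
      rw [homEval_toMvPolynomial t i (Polynomial.natDegree_X_sub_C a).le]
      simp [Finset.sum_range_succ, Polynomial.coeff_X, Algebra.smul_def, sub_eq_neg_add]
    rw [rootPoly, rootForm, Finset.prod_insert ha, Finset.prod_insert ha,
      Finset.card_insert_of_notMem ha, add_comm, ← rootPoly, ← rootForm,
      homEval_toMvPolynomial_mul t i (Polynomial.natDegree_X_sub_C a).le (natDegree_rootPoly A).le,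
      ih, hlinear]

end HomogeneousEvaluation

section Fibres

variable {k R : Type*} [Field k] [CommRing R] [Algebra k R]

lemma homEval_eq_sum_of_ne {i j : Fin 2} (hij : i ≠ j) (d : Fin 2 → ℕ) (t : Fin 2 → Fin 2 → R)
    (p : MvPolynomial (Fin 2) k) :
    homEval d t p = ∑ m ∈ p.support, p.coeff m •
      ((t i 0 ^ (d i - m i) * t i 1 ^ m i) * (t j 0 ^ (d j - m j) * t j 1 ^ m j)) := by
  rw [homEval_eq_sum]
  refine Finset.sum_congr rfl fun m _ => ?_
  rw [Fintype.prod_eq_mul i j hij fun l hl => absurd hl (by omega)]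

lemma biEval_eq_homEval (p : MvPolynomial (Fin 2) k) (v w : Fin 2 → k) :
    biEval p v w = homEval (fun i => p.degreeOf i) ![v, w] p := by
  simp [biEval_eq, homEval_eq_sum]

/-- The equation of the fibre of the curve over the point with homogeneous coordinates `v` of the
`i`-th projective line, in the affine coordinate of the other projective line. -/
def fibrePoly (i : Fin 2) (v : Fin 2 → k) (p : MvPolynomial (Fin 2) k) : Polynomial k :=
  homEval (fun l => p.degreeOf l)
    (fun l => if l = i then Polynomial.C ∘ v else ![1, Polynomial.X]) p

lemma fibrePoly_eq_sum {i j : Fin 2} (hij : i ≠ j) (v : Fin 2 → k) (p : MvPolynomial (Fin 2) k) :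
    fibrePoly i v p = ∑ m ∈ p.support, Polynomial.monomial (m j)
      (p.coeff m * (v 0 ^ (p.degreeOf i - m i) * v 1 ^ m i)) := by
  rw [fibrePoly, homEval_eq_sum_of_ne hij]
  refine Finset.sum_congr rfl fun m _ => ?_
  rw [← Polynomial.C_mul_X_pow_eq_monomial]
  simp [hij.symm, Polynomial.smul_eq_C_mul, mul_assoc]

lemma natDegree_fibrePoly_le {i j : Fin 2} (hij : i ≠ j) (v : Fin 2 → k)
    (p : MvPolynomial (Fin 2) k) : (fibrePoly i v p).natDegree ≤ p.degreeOf j := by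
  rw [fibrePoly_eq_sum hij]
  exact Polynomial.natDegree_sum_le_of_forall_le _ _ fun m hm =>
    (Polynomial.natDegree_monomial_le _).trans (MvPolynomial.monomial_le_degreeOf j hm)

lemma homEval_eq_homEval_fibrePoly {i j : Fin 2} (hij : i ≠ j) {t : Fin 2 → Fin 2 → R} {s : R}
    {v : Fin 2 → k} (ht : t i = s • (algebraMap k R ∘ v)) (p : MvPolynomial (Fin 2) k) :
    homEval (fun l => p.degreeOf l) t p =
      s ^ p.degreeOf i *
        homEval (Pi.single j (p.degreeOf j)) t ((fibrePoly i v p).toMvPolynomial j) := by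
  rw [homEval_eq_sum_of_ne hij, fibrePoly_eq_sum hij, map_sum, map_sum, Finset.mul_sum]
  refine Finset.sum_congr rfl fun m hm => ?_
  have hi := MvPolynomial.monomial_le_degreeOf i hm
  have hj := MvPolynomial.monomial_le_degreeOf j hm
  have hs : s ^ p.degreeOf i = s ^ (p.degreeOf i - m i) * s ^ m i := by
    rw [← pow_add, Nat.sub_add_cancel hi]
  rw [homEval_toMvPolynomial t j ((Polynomial.natDegree_monomial_le _).trans hj),
    Finset.sum_eq_single (m j)
      (fun n _ hn => by rw [Polynomial.coeff_monomial_of_ne _ hn, zero_smul])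
      (fun h => absurd (Finset.mem_range_succ_iff.2 hj) h), Polynomial.coeff_monomial_same, ht, hs]
  simp only [Algebra.smul_def (R := k), Pi.smul_apply, Function.comp_apply, smul_eq_mul, map_mul,
    map_pow, mul_pow]
  ring

lemma homEval_eq_eval_fibrePoly {i j : Fin 2} (hij : i ≠ j) {t : Fin 2 → Fin 2 → k} {b : k}
    (ht : t j = ![1, b]) (p : MvPolynomial (Fin 2) k) :
    homEval (fun l => p.degreeOf l) t p = (fibrePoly i (t i) p).eval b := by
  rw [homEval_eq_homEval_fibrePoly hij (s := 1) (v := t i) (by simp),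
    homEval_toMvPolynomial t j (natDegree_fibrePoly_le hij _ p),
    Polynomial.eval_eq_sum_range' (Nat.lt_succ_of_le (natDegree_fibrePoly_le hij _ p))]
  simp [ht]

lemma homEval_eq_coeff_fibrePoly {i j : Fin 2} (hij : i ≠ j) {t : Fin 2 → Fin 2 → k}
    (ht : t j = ![0, 1]) (p : MvPolynomial (Fin 2) k) :
    homEval (fun l => p.degreeOf l) t p = (fibrePoly i (t i) p).coeff (p.degreeOf j) := by
  rw [homEval_eq_homEval_fibrePoly hij (s := 1) (v := t i) (by simp),
    homEval_toMvPolynomial t j (natDegree_fibrePoly_le hij _ p), Finset.sum_range_succ,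
    Finset.sum_eq_zero fun m hm => ?_]
  · simp [ht]
  · simp [ht, (Nat.sub_pos_of_lt (Finset.mem_range.1 hm)).ne']

lemma eval_fibrePoly_comm {i j : Fin 2} (hij : i ≠ j) (a b : k) (p : MvPolynomial (Fin 2) k) :
    (fibrePoly i ![1, a] p).eval b = (fibrePoly j ![1, b] p).eval a := by
  have hi := homEval_eq_eval_fibrePoly hij (t := fun l => ![1, if l = i then a else b])
    (b := b) (by simp [hij.symm]) p
  have hj := homEval_eq_eval_fibrePoly hij.symm (t := fun l => ![1, if l = i then a else b])
    (b := a) (by simp) p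
  simpa [hij.symm] using hi.symm.trans hj

end Fibres

section UnramifiedPairs

variable {k : Type*} [Field k] {p : MvPolynomial (Fin 2) k} {A : Fin 2 → Finset k}

/-- A pair of finite sets of affine values such that the fibre of the curve over each value in one
of the sets is reduced and lies over the other set. The degree condition says that the fibre has no
point at infinity, the divisibility that its other points are simple and lie over the other set. -/
def IsUnramifiedPair (p : MvPolynomial (Fin 2) k) (A : Fin 2 → Finset k) : Prop :=
  ∀ i j, i ≠ j → ∀ a ∈ A i,
    (fibrePoly i ![1, a] p).natDegree = p.degreeOf j ∧ fibrePoly i ![1, a] p ∣ rootPoly (A j)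

lemma IsUnramifiedPair.card_filter_isRoot [DecidableEq k] (hA : IsUnramifiedPair p A) {i j : Fin 2}
    (hij : i ≠ j) {a : k} (ha : a ∈ A i) :
    {b ∈ A j | (fibrePoly i ![1, a] p).eval b = 0}.card = p.degreeOf j := by
  obtain ⟨hdeg, hdvd⟩ := hA i j hij a ha
  have hne : rootPoly (A j) ≠ 0 := (Polynomial.monic_prod_X_sub_C id _).ne_zero
  have hroots : (rootPoly (A j)).roots = (A j).val := Polynomial.roots_prod_X_sub_C (A j)
  have hsplits : (fibrePoly i ![1, a] p).Splits :=
    (Polynomial.Splits.prod fun _ _ => Polynomial.Splits.X_sub_C _).of_dvd hne hdvd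
  have hle : (fibrePoly i ![1, a] p).roots ≤ (A j).val :=
    hroots ▸ Polynomial.roots.le_of_dvd hne hdvd
  have hnodup := Multiset.nodup_of_le hle (A j).nodup
  rw [← hdeg, hsplits.natDegree_eq_card_roots, ← Multiset.toFinset_card_of_nodup hnodup]
  congr 1
  ext b
  simp only [Finset.mem_filter, Multiset.mem_toFinset, Polynomial.mem_roots (ne_zero_of_dvd_ne_zero
    hne hdvd), Polynomial.IsRoot.def, and_iff_right_iff_imp]
  exact fun hb => Multiset.mem_of_le hle
    ((Polynomial.mem_roots (ne_zero_of_dvd_ne_zero hne hdvd)).2 hb)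

lemma IsUnramifiedPair.card_mul_degreeOf (hA : IsUnramifiedPair p A) :
    (A 0).card * p.degreeOf 1 = (A 1).card * p.degreeOf 0 := by
  classical
  refine Finset.card_mul_eq_card_mul (fun a b => (fibrePoly 0 ![1, a] p).eval b = 0)
    (fun a ha => hA.card_filter_isRoot zero_ne_one ha) (fun b hb => ?_)
  rw [← hA.card_filter_isRoot one_ne_zero hb]
  simp only [Finset.bipartiteBelow, eval_fibrePoly_comm zero_ne_one]

variable {R : Type*} [CommRing R] [Algebra k R]

lemma IsUnramifiedPair.rootForm_eq_zero (hA : IsUnramifiedPair p A) {i j : Fin 2} (hij : i ≠ j)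
    {t : Fin 2 → Fin 2 → R} (ht : homEval (fun l => p.degreeOf l) t p = 0) {a : k} (ha : a ∈ A i)
    (hunit : IsUnit (t i 0)) (hta : t i 1 = algebraMap k R a * t i 0) :
    rootForm (A j) (t j) = 0 := by
  obtain ⟨hdeg, q, hq⟩ := hA i j hij a ha
  have hti : t i = t i 0 • (algebraMap k R ∘ ![1, a]) := by
    ext l
    fin_cases l <;> simp [hta, mul_comm]
  have hfibre :
      homEval (Pi.single j (p.degreeOf j)) t ((fibrePoly i ![1, a] p).toMvPolynomial j) = 0 := by
    rwa [homEval_eq_homEval_fibrePoly hij hti, (hunit.pow _).mul_right_eq_zero] at ht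
  have hne : rootPoly (A j) ≠ 0 := (Polynomial.monic_prod_X_sub_C id _).ne_zero
  have hcard : (A j).card = p.degreeOf j + q.natDegree := by
    rw [← natDegree_rootPoly, hq, ← hdeg]
    rw [hq] at hne
    exact Polynomial.natDegree_mul (left_ne_zero_of_mul hne) (right_ne_zero_of_mul hne)
  rw [← homEval_rootPoly, hcard, hq, homEval_toMvPolynomial_mul t j hdeg.le le_rfl, hfibre,
    zero_mul]

lemma IsUnramifiedPair.dvd_rootForm (hA : IsUnramifiedPair p A) {i j : Fin 2} (hij : i ≠ j)
    {t : Fin 2 → Fin 2 → R} (ht : homEval (fun l => p.degreeOf l) t p = 0) {a : k} (ha : a ∈ A i)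
    (hunit : IsUnit (t i 0)) : t i 1 - algebraMap k R a * t i 0 ∣ rootForm (A j) (t j) := by
  let I := Ideal.span {t i 1 - algebraMap k R a * t i 0}
  let π := Ideal.Quotient.mkₐ k I
  have hπt : homEval (fun l => p.degreeOf l) (fun l => π ∘ t l) p = 0 := by
    rw [← map_homEval, ht, map_zero]
  have hπa : π (t i 1) = algebraMap k (R ⧸ I) a * π (t i 0) := by
    rw [← AlgHom.commutes π, ← map_mul, ← sub_eq_zero, ← map_sub]
    exact Ideal.Quotient.eq_zero_iff_mem.2 (Ideal.mem_span_singleton_self _)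
  have hzero := hA.rootForm_eq_zero hij hπt ha (hunit.map π) hπa
  rw [← map_rootForm] at hzero
  exact Ideal.mem_span_singleton.1 (Ideal.Quotient.eq_zero_iff_mem.1 hzero)

/-- In a local ring only one linear factor of the form can be a non-unit. -/
lemma IsUnramifiedPair.rootForm_dvd_rootForm [IsLocalRing R] (hA : IsUnramifiedPair p A)
    {i j : Fin 2} (hij : i ≠ j) {t : Fin 2 → Fin 2 → R}
    (ht : homEval (fun l => p.degreeOf l) t p = 0) (hti : IsUnit (t i 0) ∨ IsUnit (t i 1)) :
    rootForm (A i) (t i) ∣ rootForm (A j) (t j) := by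
  classical
  by_cases hunits : ∀ a ∈ A i, IsUnit (t i 1 - algebraMap k R a * t i 0)
  · exact (Finset.prod_induction _ IsUnit (fun _ _ => IsUnit.mul) isUnit_one hunits).dvd
  push Not at hunits
  obtain ⟨a, ha, hnonunit⟩ := hunits
  have hunit : IsUnit (t i 0) := by
    by_contra h
    refine hti.elim h fun h1 => ?_
    rw [← sub_add_cancel (t i 1) (algebraMap k R a * t i 0)] at h1
    exact (IsLocalRing.isUnit_or_isUnit_of_isUnit_add h1).elim hnonunit
      fun h0 => h (isUnit_of_mul_isUnit_right h0)
  have hothers : ∀ b ∈ (A i).erase a, IsUnit (t i 1 - algebraMap k R b * t i 0) := fun b hb => by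
    have hab : IsUnit (algebraMap k R (a - b) * t i 0) :=
      ((isUnit_iff_ne_zero.2 (sub_ne_zero.2 (Finset.ne_of_mem_erase hb).symm)).map _).mul hunit
    have hsplit : algebraMap k R (a - b) * t i 0 =
        (t i 1 - algebraMap k R b * t i 0) + -(t i 1 - algebraMap k R a * t i 0) := by
      rw [map_sub]; ring
    rw [hsplit] at hab
    exact (IsLocalRing.isUnit_or_isUnit_of_isUnit_add hab).resolve_right
      fun h => hnonunit ((IsUnit.neg_iff _).1 h)
  rw [rootForm, ← Finset.mul_prod_erase _ _ ha, IsUnit.mul_right_dvd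
    (Finset.prod_induction _ IsUnit (fun _ _ => IsUnit.mul) isUnit_one hothers)]
  exact hA.dvd_rootForm hij ht ha hunit

end UnramifiedPairs

section CrossPolynomials

variable {k : Type*} [Field k]

lemma degreeOf_rootPoly_pow_le (A : Finset k) (α : ℕ) (i l : Fin 2) :
    ((rootPoly A).toMvPolynomial i ^ α).degreeOf l ≤
      Pi.single (M := fun _ => ℕ) i (α * A.card) l := by
  rw [← map_pow]
  refine degreeOf_toMvPolynomial_le ?_ i l
  rw [Polynomial.natDegree_pow, natDegree_rootPoly]

lemma homEval_rootPoly_pow {R : Type*} [CommRing R] [Algebra k R] (t : Fin 2 → Fin 2 → R)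
    (A : Finset k) (α : ℕ) (i : Fin 2) :
    homEval (Pi.single i (α * A.card)) t ((rootPoly A).toMvPolynomial i ^ α) =
      rootForm A (t i) ^ α := by
  rw [← smul_eq_mul, Pi.single_smul,
    homEval_pow t (degreeOf_toMvPolynomial_le (natDegree_rootPoly A).le i), homEval_rootPoly]

lemma single_add_single_of_ne {i j : Fin 2} (hij : i ≠ j) (d : Fin 2 → ℕ) :
    Pi.single i (d i) + Pi.single j (d j) = d := by
  ext l
  obtain rfl | rfl : l = i ∨ l = j := by omega
  · simp [hij]
  · simp [hij.symm]

/-- The function `A i ^ α * B j ^ β` on the product of two lines, where each finite set stands for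
the monic polynomial in the respective variable with simple roots at its points. -/
def crossPoly (A B : Fin 2 → Finset k) (α β : ℕ) (i j : Fin 2) : MvPolynomial (Fin 2) k :=
  (rootPoly (A i)).toMvPolynomial i ^ α * (rootPoly (B j)).toMvPolynomial j ^ β

variable {A B : Fin 2 → Finset k} {α β : ℕ} {i j : Fin 2} {d : Fin 2 → ℕ}

lemma degreeOf_crossPoly_le (hij : i ≠ j) (hA : α * (A i).card = d i) (hB : β * (B j).card = d j)
    (l : Fin 2) : (crossPoly A B α β i j).degreeOf l ≤ d l := by
  rw [← single_add_single_of_ne hij d, ← hA, ← hB]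
  exact (MvPolynomial.degreeOf_mul_le _ _ _).trans (add_le_add
    (degreeOf_rootPoly_pow_le (A i) α i l) (degreeOf_rootPoly_pow_le (B j) β j l))

lemma homEval_crossPoly {R : Type*} [CommRing R] [Algebra k R] (hij : i ≠ j)
    (hA : α * (A i).card = d i) (hB : β * (B j).card = d j) (t : Fin 2 → Fin 2 → R) :
    homEval d t (crossPoly A B α β i j) = rootForm (A i) (t i) ^ α * rootForm (B j) (t j) ^ β := by
  rw [← single_add_single_of_ne hij d, ← hA, ← hB, crossPoly,
    homEval_mul t (degreeOf_rootPoly_pow_le (A i) α i) (degreeOf_rootPoly_pow_le (B j) β j),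
    homEval_rootPoly_pow, homEval_rootPoly_pow]

end CrossPolynomials

section ConstantFunctions

variable {k K : Type*} [Field k] [Field K] [Algebra k K]

lemma exists_unimodular_smul (V : ValuationSubring K) (x : K) :
    ∃ s : K, s ≠ 0 ∧ ∃ u : Fin 2 → V, V.subtype ∘ u = s • ![1, x] ∧
      (IsUnit (u 0) ∨ IsUnit (u 1)) := by
  by_cases hx : x ∈ V
  · exact ⟨1, one_ne_zero, ![1, ⟨x, hx⟩], by ext l; fin_cases l <;> simp, .inl isUnit_one⟩
  · have hx0 : x ≠ 0 := fun h => hx (h ▸ V.zero_mem)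
    refine ⟨x⁻¹, inv_ne_zero hx0, ![⟨x⁻¹, (V.mem_or_inv_mem x).resolve_left hx⟩, 1], ?_,
      .inr isUnit_one⟩
    ext l
    fin_cases l <;> simp [hx0]

lemma exists_mem_crossPoly_eq_mul {p : MvPolynomial (Fin 2) k} {A B : Fin 2 → Finset k} {α β : ℕ}
    (hA : IsUnramifiedPair p A) (hB : IsUnramifiedPair p B)
    (hcard : ∀ i, α * (A i).card = β * (B i).card) {x : Fin 2 → K}
    (hx : MvPolynomial.aeval x p = 0) {V : ValuationSubring K} (hV : ∀ c, algebraMap k K c ∈ V) :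
    ∃ q ∈ V, MvPolynomial.aeval x (crossPoly A B α β 1 0) =
      MvPolynomial.aeval x (crossPoly A B α β 0 1) * q := by
  let _ : Algebra k V := ((algebraMap k K).codRestrict V.toSubring hV).toAlgebra
  let ι : V →ₐ[k] K := { V.subtype with commutes' := fun _ => rfl }
  choose s hs t ht hunit using fun i => exists_unimodular_smul V (x i)
  have hι : ∀ {d : Fin 2 → ℕ} {q : MvPolynomial (Fin 2) k}, (∀ i, q.degreeOf i ≤ d i) →
      ι (homEval d t q) = (∏ i, s i ^ d i) * MvPolynomial.aeval x q := fun {d q} hq => by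
    rw [map_homEval, ← homEval_smul_affine s x hq]
    exact congrArg (homEval d · q) (funext ht)
  have hp : homEval (fun l => p.degreeOf l) t p = 0 := by
    refine Subtype.val_injective ?_
    change ι _ = 0
    rw [hι fun _ => le_rfl, hx, mul_zero]
  have hdvd : rootForm (A 0) (t 0) ^ α * rootForm (B 1) (t 1) ^ β ∣
      rootForm (A 1) (t 1) ^ α * rootForm (B 0) (t 0) ^ β :=
    mul_dvd_mul (pow_dvd_pow_of_dvd (hA.rootForm_dvd_rootForm zero_ne_one hp (hunit 0)) α)
      (pow_dvd_pow_of_dvd (hB.rootForm_dvd_rootForm one_ne_zero hp (hunit 1)) β)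
  let d : Fin 2 → ℕ := fun i => α * (A i).card
  have hd : ∏ i, s i ^ d i ≠ 0 := Finset.prod_ne_zero_iff.2 fun i _ => pow_ne_zero _ (hs i)
  rw [← homEval_crossPoly (d := d) zero_ne_one rfl (hcard 1).symm,
    ← homEval_crossPoly (d := d) one_ne_zero rfl (hcard 0).symm] at hdvd
  obtain ⟨q, hq⟩ := hdvd
  have hq' := congrArg ι hq
  rw [map_mul, hι (degreeOf_crossPoly_le (d := d) one_ne_zero rfl (hcard 0).symm),
    hι (degreeOf_crossPoly_le (d := d) zero_ne_one rfl (hcard 1).symm), mul_assoc] at hq'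
  exact ⟨q, q.2, mul_left_cancel₀ hd hq'⟩

lemma exists_algebraMap_eq_of_forall_mem_valuationSubring [IsAlgClosed k] {u : K}
    (h : ∀ V : ValuationSubring K, (∀ c, algebraMap k K c ∈ V) → u ∈ V) :
    ∃ c, algebraMap k K c = u := by
  have hmem : u ∈ ⨅ V : {V : ValuationSubring K // ((algebraMap k K).range : Set K) ⊆ V.toSubring},
      V.1.toSubring :=
    Subring.mem_iInf.2 fun V => h V.1 fun c => V.2 ⟨c, rfl⟩
  rw [iInf_valuationSubring_superset, Subring.closure_eq] at hmem
  have hint : IsIntegral (algebraMap k K).range u := hmem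
  let _ : Algebra k (algebraMap k K).range := (algebraMap k K).rangeRestrict.toAlgebra
  have : IsScalarTower k (algebraMap k K).range K := .of_algebraMap_eq fun _ => rfl
  have : Algebra.IsIntegral k (algebraMap k K).range :=
    Algebra.isIntegral_of_surjective (algebraMap k K).rangeRestrict_surjective
  have hk : IsIntegral k u := isIntegral_trans (R := k) (A := (algebraMap k K).range) u hint
  exact hk.mem_range_algebraMap_of_minpoly_splits (IsAlgClosed.splits _)

lemma exists_genericPoint.{u, v} {σ : Type u} {k : Type v} [Field k] {p : MvPolynomial σ k}
    (hp : Prime p) : ∃ (K : Type (max u v)) (_ : Field K) (_ : Algebra k K)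
      (x : σ → K), ∀ q : MvPolynomial σ k, MvPolynomial.aeval x q = 0 ↔ p ∣ q := by
  have hprime : (Ideal.span {p}).IsPrime := (Ideal.span_singleton_prime hp.ne_zero).2 hp
  let R := MvPolynomial σ k ⧸ Ideal.span {p}
  let π : MvPolynomial σ k →ₐ[k] FractionRing R :=
    (IsScalarTower.toAlgHom k R (FractionRing R)).comp (Ideal.Quotient.mkₐ k (Ideal.span {p}))
  refine ⟨FractionRing R, inferInstance, inferInstance, π ∘ MvPolynomial.X, fun q => ?_⟩
  rw [← MvPolynomial.aeval_unique π, ← Ideal.mem_span_singleton, ← Ideal.Quotient.eq_zero_iff_mem]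
  exact map_eq_zero_iff _ (IsFractionRing.injective R (FractionRing R))

lemma not_dvd_toMvPolynomial {σ : Type*} {p : MvPolynomial σ k} {i j : σ} (hij : i ≠ j)
    (hj : 0 < p.degreeOf j) {f : Polynomial k} (hf : f ≠ 0) : ¬ p ∣ f.toMvPolynomial i := by
  classical
  rintro ⟨q, hq⟩
  have hpq : p * q ≠ 0 := by
    rw [← hq]
    exact (map_ne_zero_iff _ (Polynomial.toMvPolynomial_injective i)).2 hf
  have hle := degreeOf_toMvPolynomial_le (f := f) le_rfl i j
  rw [hq, MvPolynomial.degreeOf_mul_eq (left_ne_zero_of_mul hpq) (right_ne_zero_of_mul hpq),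
    Pi.single_eq_of_ne hij.symm] at hle
  omega

lemma not_dvd_crossPoly {p : MvPolynomial (Fin 2) k} (hp : Prime p) (hdeg : ∀ l, 0 < p.degreeOf l)
    (A B : Fin 2 → Finset k) (α β : ℕ) (i j : Fin 2) : ¬ p ∣ crossPoly A B α β i j := by
  have hfactor : ∀ (C : Finset k) (l : Fin 2), ¬ p ∣ (rootPoly C).toMvPolynomial l := fun C l =>
    have ⟨m, hm⟩ := exists_ne l
    not_dvd_toMvPolynomial hm.symm (hdeg m) (Polynomial.monic_prod_X_sub_C id C).ne_zero
  exact fun h => (hp.dvd_or_dvd h).elim (fun h => hfactor _ _ (hp.dvd_of_dvd_pow h))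
    fun h => hfactor _ _ (hp.dvd_of_dvd_pow h)

/-- The ratio of the two functions has no poles, so it is constant on the curve. -/
theorem exists_dvd_crossPoly_sub [IsAlgClosed k] {p : MvPolynomial (Fin 2) k} (hp : Prime p)
    (hdeg : ∀ l, 0 < p.degreeOf l) {A B : Fin 2 → Finset k} (hA : IsUnramifiedPair p A)
    (hB : IsUnramifiedPair p B) {α β : ℕ} (hcard : ∀ i, α * (A i).card = β * (B i).card) :
    ∃ c : k, c ≠ 0 ∧ p ∣ crossPoly A B α β 1 0 - c • crossPoly A B α β 0 1 := by
  obtain ⟨K, _, _, x, hx⟩ := exists_genericPoint hp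
  have hne : ∀ i j, MvPolynomial.aeval x (crossPoly A B α β i j) ≠ 0 := fun i j =>
    (hx _).not.2 (not_dvd_crossPoly hp hdeg A B α β i j)
  obtain ⟨c, hc⟩ := exists_algebraMap_eq_of_forall_mem_valuationSubring (k := k)
    (u := MvPolynomial.aeval x (crossPoly A B α β 1 0) /
      MvPolynomial.aeval x (crossPoly A B α β 0 1)) fun V hV => by
    obtain ⟨q, hqV, hq⟩ := exists_mem_crossPoly_eq_mul hA hB hcard ((hx p).2 dvd_rfl) hV
    rwa [hq, mul_div_cancel_left₀ _ (hne 0 1)]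
  refine ⟨c, ?_, (hx _).1 ?_⟩
  · rintro rfl
    exact div_ne_zero (hne 1 0) (hne 0 1) (by rw [← hc, map_zero])
  · rw [map_sub, map_smul, Algebra.smul_def, hc, div_mul_cancel₀ _ (hne 0 1), sub_self]

end ConstantFunctions

section IteratedRelations

variable {X Y : Type*} {R : SetRel X X}

lemma iter_subset_ker {φ : X → Y} (hφ : ∀ x y, (x, y) ∈ R → φ x = φ y) (n : ℕ) {x y : X}
    (hxy : (x, y) ∈ iter R n) : φ x = φ y := by
  induction n generalizing y with
  | zero => exact congrArg φ hxy
  | succ n ih =>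
    obtain ⟨z, hxz, hzy⟩ := hxy
    exact (ih hxz).trans (hφ z y hzy)

lemma iter_eq_iter_succ [R.IsRefl] {φ : X → Y} (hφ : ∀ x y, (x, y) ∈ R → φ x = φ y) {N : ℕ}
    (hfin : ∀ x, {y | φ x = φ y}.Finite) (hcard : ∀ x, {y | φ x = φ y}.ncard ≤ N) :
    iter R N = iter R (N + 1) := by
  let S : X → ℕ → Set X := fun x n => (iter R n).image {x}
  have hS : ∀ x n, S x (n + 1) = R.image (S x n) := fun x n => SetRel.image_comp _ _ {x}
  have hker : ∀ x n, S x n ⊆ {y | φ x = φ y} := by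
    rintro x n y ⟨_, rfl, hy⟩
    exact iter_subset_ker hφ n hy
  have hSfin : ∀ x n, (S x n).Finite := fun x n => (hfin x).subset (hker x n)
  have hsucc : ∀ x n, S x n ⊆ S x (n + 1) := fun x n y hy => hS x n ▸ ⟨y, hy, R.rfl⟩
  have hncard : ∀ x, (S x (N + 1)).ncard = (S x N).ncard := fun x =>
    Nat.stabilises_of_monotone (f := fun n => (S x n).ncard)
      (monotone_nat_of_le_succ fun n => Set.ncard_le_ncard (hsucc x n) (hSfin x _))
      (fun n => (Set.ncard_le_ncard (hker x n) (hfin x)).trans (hcard x))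
      (fun n hn => by
        have heq := Set.eq_of_subset_of_ncard_le (hsucc x n) hn.ge (hSfin x _)
        change (S x (n + 1)).ncard = (S x (n + 1 + 1)).ncard
        rw [hS x (n + 1), ← heq, ← hS, ← heq])
      N.le_succ
  ext ⟨x, y⟩
  have hx := Set.eq_of_subset_of_ncard_le (hsucc x N) (hncard x).le (hSfin x _)
  simpa [S] using Set.ext_iff.1 hx y

end IteratedRelations

section ProjectiveLine

variable {k : Type*} [Field k]

lemma mk_eq_mk_iff_mul_eq_mul {v w : Fin 2 → k} (hv : v ≠ 0) (hw : w ≠ 0) :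
    Projectivization.mk k v hv = Projectivization.mk k w hw ↔ v 0 * w 1 = w 0 * v 1 := by
  rw [Projectivization.mk_eq_mk_iff']
  constructor
  · rintro ⟨a, rfl⟩
    simp only [Pi.smul_apply, smul_eq_mul]
    ring
  · intro h
    obtain ⟨l, hl⟩ := Function.ne_iff.1 hw
    refine ⟨v l / w l, funext fun m => ?_⟩
    rw [Pi.smul_apply, smul_eq_mul, div_mul_eq_mul_div, div_eq_iff hl]
    fin_cases l <;> fin_cases m <;> grind

/-- The point of the projective line with affine coordinate `a`. -/
def affinePoint (a : k) : P1 k := Projectivization.mk k ![1, a] (by simp)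

variable (k) in
/-- The point at infinity of the projective line. -/
def infinitePoint : P1 k := Projectivization.mk k ![0, 1] (by simp)

lemma eq_affinePoint_or_eq_infinitePoint (z : P1 k) :
    (∃ a, z = affinePoint a) ∨ z = infinitePoint k := by
  induction z using Projectivization.ind with
  | h v hv =>
    by_cases h : v 0 = 0
    · exact .inr ((mk_eq_mk_iff_mul_eq_mul _ _).2 (by simp [h]))
    · exact .inl ⟨v 1 / v 0, (mk_eq_mk_iff_mul_eq_mul _ _).2 (by simp [mul_div_cancel₀ _ h])⟩

lemma affinePoint_injective : Function.Injective (affinePoint : k → P1 k) := fun a b h => by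
  simpa using ((mk_eq_mk_iff_mul_eq_mul _ _).1 h).symm

lemma ncard_le_of_forall_affinePoint {S : Set (P1 k)} {g : Polynomial k} (hg : g ≠ 0)
    (hS : ∀ a, affinePoint a ∈ S → g.eval a = 0) : S.Finite ∧ S.ncard ≤ g.natDegree + 1 := by
  classical
  let T : Finset (P1 k) := insert (infinitePoint k) (g.roots.toFinset.image affinePoint)
  have hST : S ⊆ T := fun z hz => by
    obtain ⟨a, rfl⟩ | rfl := eq_affinePoint_or_eq_infinitePoint z
    · refine Finset.mem_coe.2 (Finset.mem_insert_of_mem (Finset.mem_image_of_mem _ ?_))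
      exact Multiset.mem_toFinset.2 ((Polynomial.mem_roots hg).2 (hS a hz))
    · exact Finset.mem_coe.2 (Finset.mem_insert_self _ _)
  have hT : T.card ≤ g.natDegree + 1 :=
    (Finset.card_insert_le _ _).trans (Nat.add_le_add_right (Finset.card_image_le.trans
      ((Multiset.toFinset_card_le _).trans (Polynomial.card_roots' g))) 1)
  exact ⟨T.finite_toSet.subset hST,
    (Set.ncard_le_ncard hST T.finite_toSet).trans ((Set.ncard_coe_finset T).trans_le hT)⟩

end ProjectiveLine

section Coordinates

variable {k : Type*} [Field k] {p : MvPolynomial (Fin 2) k}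

/-- The two coordinates of a point of the curve. -/
def coordinate (i : Fin 2) (z : curve p) : P1 k := ![z.1.1, z.1.2] i

lemma homEval_coordinate_rep (z : curve p) :
    homEval (fun l => p.degreeOf l) (fun i => (coordinate i z).rep) p = 0 := by
  have hrep : (fun i => (coordinate i z).rep) = ![z.1.1.rep, z.1.2.rep] :=
    funext (Fin.forall_fin_two.2 ⟨rfl, rfl⟩)
  rw [hrep, ← biEval_eq_homEval]
  exact z.2

lemma exists_coordinate_eq_mk {t : Fin 2 → Fin 2 → k} (hne : ∀ i, t i ≠ 0)
    (ht : homEval (fun l => p.degreeOf l) t p = 0) :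
    ∃ z : curve p, ∀ i, coordinate i z = Projectivization.mk k (t i) (hne i) := by
  have hmem : biEval p (t 0) (t 1) = 0 := by
    rw [biEval_eq_homEval, ← ht]
    congr 1
  refine ⟨⟨(_, _), (mem_curve_mk p (t 0) (t 1) (hne 0) (hne 1)).2 hmem⟩, fun i => ?_⟩
  fin_cases i <;> rfl

lemma exists_coordinate_eq_affinePoint {i j : Fin 2} (hij : i ≠ j) {v : Fin 2 → k} (hv : v ≠ 0)
    {b : k} (hb : (fibrePoly i v p).eval b = 0) :
    ∃ z : curve p, coordinate i z = Projectivization.mk k v hv ∧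
      coordinate j z = affinePoint b := by
  obtain ⟨z, hz⟩ := exists_coordinate_eq_mk (p := p) (t := Function.update (fun _ => ![1, b]) i v)
    (fun l => by obtain rfl | hl := eq_or_ne l i <;> simp [*])
    (by rw [homEval_eq_eval_fibrePoly hij (b := b)] <;> simp [hij.symm, hb])
  exact ⟨z, by simp [hz], by simp [hz, hij.symm, affinePoint]⟩

lemma exists_coordinate_eq_infinitePoint {i j : Fin 2} (hij : i ≠ j) {v : Fin 2 → k} (hv : v ≠ 0)
    (hcoeff : (fibrePoly i v p).coeff (p.degreeOf j) = 0) :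
    ∃ z : curve p, coordinate i z = Projectivization.mk k v hv ∧
      coordinate j z = infinitePoint k := by
  obtain ⟨z, hz⟩ := exists_coordinate_eq_mk (p := p) (t := Function.update (fun _ => ![0, 1]) i v)
    (fun l => by obtain rfl | hl := eq_or_ne l i <;> simp [*])
    (by rw [homEval_eq_coeff_fibrePoly hij] <;> simp [hij.symm, hcoeff])
  exact ⟨z, by simp [hz], by simp [hz, hij.symm, infinitePoint]⟩

lemma coordinate_surjective [IsAlgClosed k] {i j : Fin 2} (hij : i ≠ j) (hj : 0 < p.degreeOf j) :
    Function.Surjective (coordinate i : curve p → P1 k) := fun z => by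
  induction z using Projectivization.ind with
  | h v hv =>
    by_cases hcoeff : (fibrePoly i v p).coeff (p.degreeOf j) = 0
    · exact (exists_coordinate_eq_infinitePoint hij hv hcoeff).imp fun _ h => h.1
    · have hdeg : (fibrePoly i v p).degree ≠ 0 := fun h =>
        hcoeff (Polynomial.coeff_eq_zero_of_degree_lt (by rw [h]; exact_mod_cast hj))
      obtain ⟨b, hb⟩ := IsAlgClosed.exists_root _ hdeg
      exact (exists_coordinate_eq_affinePoint hij hv hb).imp fun _ h => h.1

lemma roundTrip_isRefl [IsAlgClosed k] (hp : 0 < p.degreeOf 1) : (roundTrip p).IsRefl where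
  refl x := by
    obtain ⟨z, rfl⟩ := coordinate_surjective zero_ne_one hp x
    exact ⟨z.1.2, z.2, z.2⟩

end Coordinates

section Finiteness

variable {k : Type*} [Field k] {p : MvPolynomial (Fin 2) k} {A B : Fin 2 → Finset k} {α β : ℕ}

lemma rootForm_smul (A : Finset k) (s : k) (v : Fin 2 → k) :
    rootForm A (s • v) = s ^ A.card * rootForm A v := by
  rw [rootForm, rootForm, ← Finset.prod_const, ← Finset.prod_mul_distrib]
  refine Finset.prod_congr rfl fun a _ => ?_
  simp only [Pi.smul_apply, smul_eq_mul, Algebra.algebraMap_self_apply]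
  ring

lemma rootForm_affine (A : Finset k) (a : k) : rootForm A ![1, a] = (rootPoly A).eval a := by
  simp [rootForm, rootPoly, Polynomial.eval_prod]

lemma eval_rootPoly_eq_zero_iff (A : Finset k) (a : k) : (rootPoly A).eval a = 0 ↔ a ∈ A := by
  simp [rootPoly, Polynomial.eval_prod, Finset.prod_eq_zero_iff, sub_eq_zero]

lemma rootForm_ne_zero_of_disjoint {A B : Finset k} (hAB : Disjoint A B) {v : Fin 2 → k}
    (hv : v ≠ 0) (hA : rootForm A v = 0) : rootForm B v ≠ 0 := by
  rw [rootForm, Finset.prod_eq_zero_iff] at hA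
  obtain ⟨a, ha, hva⟩ := hA
  have hv1 : v 1 = a * v 0 := sub_eq_zero.1 hva
  have hv0 : v 0 ≠ 0 := fun h => hv (funext (Fin.forall_fin_two.2 ⟨h, by simp [hv1, h]⟩))
  refine Finset.prod_ne_zero_iff.2 fun b hb => ?_
  rw [hv1, Algebra.algebraMap_self_apply, ← sub_mul]
  exact mul_ne_zero (sub_ne_zero.2 fun hab => Finset.disjoint_left.1 hAB ha (hab ▸ hb)) hv0

lemma rootForm_pow_pair_ne_zero {A B : Finset k} (hAB : Disjoint A B) (α β : ℕ) {c : k}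
    (hc : c ≠ 0) {v : Fin 2 → k} (hv : v ≠ 0) :
    ![rootForm A v ^ α, c * rootForm B v ^ β] ≠ 0 := fun h => by
  have hA : rootForm A v ^ α = 0 := congrFun h 0
  have hB : c * rootForm B v ^ β = 0 := congrFun h 1
  exact rootForm_ne_zero_of_disjoint hAB hv (eq_zero_of_pow_eq_zero hA)
    (eq_zero_of_pow_eq_zero ((mul_eq_zero.1 hB).resolve_left hc))

/-- The morphism `[A ^ α : c * B ^ β]` from the projective line to itself, where `A` and `B` stand
for their root forms. It does not depend on the representative if `α * |A| = β * |B|`, see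
`pencilMap_mk`. -/
def pencilMap {A B : Finset k} (hAB : Disjoint A B) (α β : ℕ) {c : k} (hc : c ≠ 0) (z : P1 k) :
    P1 k :=
  Projectivization.mk k _ (rootForm_pow_pair_ne_zero hAB α β hc z.rep_nonzero)

lemma pencilMap_mk {A B : Finset k} (hAB : Disjoint A B) (hcard : α * A.card = β * B.card) {c : k}
    (hc : c ≠ 0) {v : Fin 2 → k} (hv : v ≠ 0) :
    pencilMap hAB α β hc (Projectivization.mk k v hv) =
      Projectivization.mk k _ (rootForm_pow_pair_ne_zero hAB α β hc hv) := by
  obtain ⟨s, hs⟩ := Projectivization.exists_smul_eq_mk_rep k v hv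
  refine (mk_eq_mk_iff_mul_eq_mul _ _).2 ?_
  have hpow : ((s : k) ^ A.card) ^ α = ((s : k) ^ B.card) ^ β := by
    rw [← pow_mul', ← pow_mul', hcard]
  simp only [← hs, Units.smul_def, rootForm_smul, mul_pow, hpow, Matrix.cons_val_zero,
    Matrix.cons_val_one]
  ring

lemma fibre_pencilMap {A B : Finset k} (hAB : Disjoint A B) (hcard : α * A.card = β * B.card)
    {c : k} (hc : c ≠ 0) (hA : A.Nonempty) (hα : α ≠ 0) (z : P1 k) :
    {w | pencilMap hAB α β hc z = pencilMap hAB α β hc w}.Finite ∧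
      {w | pencilMap hAB α β hc z = pencilMap hAB α β hc w}.ncard ≤ α * A.card + 1 := by
  let e := ![rootForm A z.rep ^ α, c * rootForm B z.rep ^ β]
  have he : e ≠ 0 := rootForm_pow_pair_ne_zero hAB α β hc z.rep_nonzero
  let g : Polynomial k :=
    Polynomial.C (e 0 * c) * rootPoly B ^ β - Polynomial.C (e 1) * rootPoly A ^ α
  have hg : g ≠ 0 := fun h => by
    obtain ⟨a, ha⟩ := hA
    have heval : ∀ b, g.eval b = 0 := by simp [h]
    have hB : (rootPoly B).eval a ≠ 0 := fun h0 =>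
      Finset.disjoint_left.1 hAB ha ((eval_rootPoly_eq_zero_iff B a).1 h0)
    have he0 : e 0 = 0 := by
      simpa [g, (eval_rootPoly_eq_zero_iff A a).2 ha, hα, hc, hB] using heval a
    have he1 : e 1 = 0 := by
      have : (rootPoly A ^ α) ≠ 0 := pow_ne_zero _ (Polynomial.monic_prod_X_sub_C id A).ne_zero
      simpa [g, he0, this] using h
    exact he (funext (Fin.forall_fin_two.2 ⟨he0, he1⟩))
  have hdeg : g.natDegree ≤ α * A.card :=
    (Polynomial.natDegree_sub_le _ _).trans (max_le
      ((Polynomial.natDegree_C_mul_le _ _).trans_eq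
        (by rw [Polynomial.natDegree_pow, natDegree_rootPoly, hcard]))
      ((Polynomial.natDegree_C_mul_le _ _).trans_eq
        (by rw [Polynomial.natDegree_pow, natDegree_rootPoly])))
  refine (ncard_le_of_forall_affinePoint hg fun a ha => ?_).imp_right
    fun h => h.trans (Nat.add_le_add_right hdeg 1)
  have hmul := (mk_eq_mk_iff_mul_eq_mul he _).1 (ha.trans (pencilMap_mk hAB hcard hc (by simp)))
  simp only [rootForm_affine, Matrix.cons_val_zero, Matrix.cons_val_one] at hmul
  simp only [g, Polynomial.eval_sub, Polynomial.eval_mul, Polynomial.eval_pow, Polynomial.eval_C]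
  linear_combination hmul

lemma rootForm_pow_mul_rootForm_pow_eq {R : Type*} [CommRing R] [Algebra k R]
    (hcard : ∀ i, α * (A i).card = β * (B i).card) {c : k}
    (hdvd : p ∣ crossPoly A B α β 1 0 - c • crossPoly A B α β 0 1) {t : Fin 2 → Fin 2 → R}
    (ht : homEval (fun l => p.degreeOf l) t p = 0) :
    rootForm (A 1) (t 1) ^ α * rootForm (B 0) (t 0) ^ β =
      c • (rootForm (A 0) (t 0) ^ α * rootForm (B 1) (t 1) ^ β) := by
  let d : Fin 2 → ℕ := fun i => α * (A i).card
  have hdeg : ∀ l, (crossPoly A B α β 1 0 - c • crossPoly A B α β 0 1).degreeOf l ≤ d l := fun l =>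
    (MvPolynomial.degreeOf_sub_le l _ _).trans (max_le
      (degreeOf_crossPoly_le one_ne_zero rfl (hcard 0).symm l)
      ((MvPolynomial.smul_eq_C_mul _ c ▸ MvPolynomial.degreeOf_C_mul_le _ l c).trans
        (degreeOf_crossPoly_le zero_ne_one rfl (hcard 1).symm l)))
  have hzero := homEval_eq_zero_of_dvd hdvd hdeg ht
  rwa [map_sub, map_smul, homEval_crossPoly one_ne_zero rfl (hcard 0).symm,
    homEval_crossPoly zero_ne_one rfl (hcard 1).symm, sub_eq_zero] at hzero

lemma pencilMap_coordinate_eq (hcard : ∀ i, α * (A i).card = β * (B i).card)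
    (hAB : ∀ i, Disjoint (A i) (B i)) {c : k} (hc : c ≠ 0)
    (hdvd : p ∣ crossPoly A B α β 1 0 - c • crossPoly A B α β 0 1) (z : curve p) :
    pencilMap (hAB 0) α β one_ne_zero (coordinate 0 z) =
      pencilMap (hAB 1) α β hc (coordinate 1 z) := by
  have hrel := rootForm_pow_mul_rootForm_pow_eq hcard hdvd (homEval_coordinate_rep z)
  refine (mk_eq_mk_iff_mul_eq_mul _ _).2 ?_
  simp only [Matrix.cons_val_zero, Matrix.cons_val_one, smul_eq_mul] at hrel ⊢
  linear_combination -hrel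

theorem isFiniteCorrespondence_of_isUnramifiedPair [IsAlgClosed k] (hirr : Irreducible p)
    (hp : ∀ l, 0 < p.degreeOf l) (hA : IsUnramifiedPair p A) (hB : IsUnramifiedPair p B)
    (hA0 : (A 0).Nonempty) (hB0 : (B 0).Nonempty) (hAB : ∀ i, Disjoint (A i) (B i)) :
    IsFiniteCorrespondence p := by
  have hcard : ∀ i, (B 0).card * (A i).card = (A 0).card * (B i).card :=
    Fin.forall_fin_two.2 ⟨mul_comm _ _, Nat.eq_of_mul_eq_mul_right (hp 0) (by
      rw [mul_assoc, mul_assoc, ← hA.card_mul_degreeOf, ← hB.card_mul_degreeOf]; ring)⟩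
  obtain ⟨c, hc, hdvd⟩ := exists_dvd_crossPoly_sub hirr.prime hp hA hB hcard
  have hcoord := pencilMap_coordinate_eq hcard hAB hc hdvd
  have := roundTrip_isRefl (hp 1)
  have hfibre := fibre_pencilMap (hAB 0) (hcard 0) one_ne_zero hA0 hB0.card_ne_zero
  refine ⟨_, Nat.succ_pos _, iter_eq_iter_succ (φ := pencilMap (hAB 0) _ _ one_ne_zero) ?_
    (fun z => (hfibre z).1) fun z => (hfibre z).2⟩
  rintro x y ⟨w, hxw, hyw⟩
  exact (hcoord ⟨(x, w), hxw⟩).trans (hcoord ⟨(y, w), hyw⟩).symm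

end Finiteness

section Resultants

lemma natDegree_resultant_le {R : Type*} [CommRing R] {f g : Polynomial (Polynomial R)} {D : ℕ}
    (hf : ∀ n, (f.coeff n).natDegree ≤ D) (hg : ∀ n, (g.coeff n).natDegree ≤ D) (m n : ℕ) :
    (Polynomial.resultant f g m n).natDegree ≤ (m + n) * D := by
  have hentry : ∀ a b, (Polynomial.sylvester f g m n a b).natDegree ≤ D := fun a b => by
    rw [Polynomial.sylvester, Matrix.of_apply]
    induction b using Fin.addCases with
    | left b =>
      rw [Fin.addCases_left]
      split_ifs
      exacts [hg _, by simp]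
    | right b =>
      rw [Fin.addCases_right]
      split_ifs
      exacts [hf _, by simp]
  rw [Polynomial.resultant, Matrix.det_apply]
  refine Polynomial.natDegree_sum_le_of_forall_le _ _ fun σ _ =>
    (Polynomial.natDegree_smul_le _ _).trans ((Polynomial.natDegree_prod_le _ _).trans ?_)
  simpa using Finset.sum_le_card_nsmul Finset.univ _ D fun l _ => hentry (σ l) l

lemma resultant_derivative_ne_zero {S : Type*} [CommRing S] [IsDomain S] [IsGCDMonoid S]
    [CharZero S] {f : Polynomial S} (hf : Irreducible f) (hdeg : f.natDegree ≠ 0) :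
    Polynomial.resultant f f.derivative ≠ 0 := by
  let K := FractionRing S
  have hinj := IsFractionRing.injective S K
  have : CharZero K := charZero_of_injective_algebraMap hinj
  have hirr : Irreducible (f.map (algebraMap S K)) :=
    ((hf.isPrimitive hdeg).irreducible_iff_irreducible_map_fraction_map).1 hf
  have hne := Polynomial.resultant_ne_zero _ _ hirr.separable
  rw [Polynomial.derivative_map, Polynomial.natDegree_map_eq_of_injective hinj,
    Polynomial.natDegree_map_eq_of_injective hinj, Polynomial.resultant_map_map] at hne
  exact fun h => hne (by rw [h, map_zero])

lemma separable_map_of_map_resultant_ne_zero {S K : Type*} [CommRing S] [Field K] (φ : S →+* K)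
    {f : Polynomial S} (hdeg : f.natDegree ≠ 0)
    (hres : φ (Polynomial.resultant f f.derivative) ≠ 0) : (f.map φ).Separable := by
  obtain ⟨u, v, -, -, huv⟩ := Polynomial.exists_mul_add_mul_eq_C_resultant f f.derivative le_rfl
    le_rfl (.inl hdeg)
  have hmap := congrArg (Polynomial.map φ) huv
  rw [Polynomial.map_add, Polynomial.map_mul, Polynomial.map_mul, ← Polynomial.derivative_map,
    Polynomial.map_C] at hmap
  set r := φ (Polynomial.resultant f f.derivative)
  refine ⟨Polynomial.C r⁻¹ * u.map φ, Polynomial.C r⁻¹ * v.map φ, ?_⟩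
  rw [mul_assoc, mul_assoc, ← mul_add, mul_comm (u.map φ), mul_comm (v.map φ), hmap,
    ← Polynomial.C_mul, inv_mul_cancel₀ hres, Polynomial.C_1]

end Resultants

section Ramification

variable {k : Type*} [Field k] {i j : Fin 2} {p : MvPolynomial (Fin 2) k}

/-- The polynomial `p` as a polynomial in the other variable, whose coefficients are polynomials in
the variable `i`. -/
def toBivariate (i : Fin 2) (p : MvPolynomial (Fin 2) k) : Polynomial (Polynomial k) :=
  MvPolynomial.aeval (fun l => if l = i then Polynomial.C Polynomial.X else Polynomial.X) p

lemma toBivariate_eq_sum (hij : i ≠ j) (p : MvPolynomial (Fin 2) k) :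
    toBivariate i p = ∑ m ∈ p.support,
      Polynomial.monomial (m j) (Polynomial.monomial (m i) (p.coeff m)) := by
  rw [toBivariate, MvPolynomial.aeval_def, MvPolynomial.eval₂_eq']
  refine Finset.sum_congr rfl fun m _ => ?_
  rw [Fintype.prod_eq_mul i j hij fun l hl => absurd hl (by omega),
    ← Polynomial.C_mul_X_pow_eq_monomial, ← Polynomial.C_mul_X_pow_eq_monomial]
  simp [hij.symm, Polynomial.algebraMap_apply, mul_assoc]

lemma map_toBivariate (hij : i ≠ j) (a : k) (p : MvPolynomial (Fin 2) k) :
    (toBivariate i p).map (Polynomial.evalRingHom a) = fibrePoly i ![1, a] p := by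
  rw [toBivariate_eq_sum hij, fibrePoly_eq_sum hij, Polynomial.map_sum]
  simp [Polynomial.map_monomial]

lemma coeff_coeff_toBivariate (hij : i ≠ j) (p : MvPolynomial (Fin 2) k) (m : Fin 2 →₀ ℕ) :
    ((toBivariate i p).coeff (m j)).coeff (m i) = p.coeff m := by
  rw [toBivariate_eq_sum hij, Polynomial.finsetSum_coeff, Polynomial.finsetSum_coeff,
    Finset.sum_eq_single m _ fun hm => by simp [MvPolynomial.notMem_support_iff.1 hm]]
  · simp
  · intro n _ hnm
    have hne : n j ≠ m j ∨ n i ≠ m i := by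
      by_contra! h
      refine hnm (Finsupp.ext fun l => ?_)
      obtain rfl | rfl : l = i ∨ l = j := by omega
      exacts [h.2, h.1]
    obtain h | h := hne
    · rw [Polynomial.coeff_monomial_of_ne _ h.symm, Polynomial.coeff_zero]
    · simp [Polynomial.coeff_monomial, h, apply_ite (Polynomial.coeff · (m i))]

lemma natDegree_toBivariate (hij : i ≠ j) (p : MvPolynomial (Fin 2) k) :
    (toBivariate i p).natDegree = p.degreeOf j := by
  refine le_antisymm ?_ (MvPolynomial.degreeOf_le_iff.2 fun m hm => ?_)
  · rw [toBivariate_eq_sum hij]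
    exact Polynomial.natDegree_sum_le_of_forall_le _ _ fun m hm =>
      (Polynomial.natDegree_monomial_le _).trans (MvPolynomial.monomial_le_degreeOf j hm)
  · refine Polynomial.le_natDegree_of_ne_zero fun h => MvPolynomial.mem_support_iff.1 hm ?_
    rw [← coeff_coeff_toBivariate hij, h, Polynomial.coeff_zero]

lemma natDegree_coeff_toBivariate_le (hij : i ≠ j) (p : MvPolynomial (Fin 2) k) (n : ℕ) :
    ((toBivariate i p).coeff n).natDegree ≤ p.degreeOf i := by
  rw [toBivariate_eq_sum hij, Polynomial.finsetSum_coeff]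
  refine Polynomial.natDegree_sum_le_of_forall_le _ _ fun m hm => ?_
  rw [Polynomial.coeff_monomial]
  split_ifs
  · exact (Polynomial.natDegree_monomial_le _).trans (MvPolynomial.monomial_le_degreeOf i hm)
  · simp

lemma irreducible_toBivariate (i : Fin 2) (hp : Irreducible p) : Irreducible (toBivariate i p) := by
  let e := (MvPolynomial.renameEquiv k (Equiv.swap 0 i)).trans
    (Polynomial.Bivariate.equivMvPolynomial k).symm
  have he : (e : MvPolynomial (Fin 2) k →ₐ[k] Polynomial (Polynomial k)) =
      MvPolynomial.aeval fun l =>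
        if l = i then Polynomial.C (Polynomial.X : Polynomial k) else Polynomial.X :=
    MvPolynomial.algHom_ext fun l => by
      obtain rfl | rfl : i = 0 ∨ i = 1 := by omega
      all_goals obtain rfl | rfl : l = 0 ∨ l = 1 := by omega
      all_goals simp [e]
  rw [toBivariate, ← he]
  exact (MulEquiv.irreducible_iff e).2 hp

/-- The resultant of `p` and its derivative with respect to the other variable, as a polynomial in
the variable `i`. Off its zeros the projection of the curve to the `i`-th line is unramified at
the points with finite coordinates. -/
def ramificationPoly (i : Fin 2) (p : MvPolynomial (Fin 2) k) : Polynomial k :=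
  Polynomial.resultant (toBivariate i p) (toBivariate i p).derivative

lemma ramificationPoly_ne_zero [CharZero k] (hij : i ≠ j) (hp : Irreducible p)
    (hj : 0 < p.degreeOf j) : ramificationPoly i p ≠ 0 :=
  resultant_derivative_ne_zero (irreducible_toBivariate i hp)
    (by rw [natDegree_toBivariate hij]; exact hj.ne')

lemma natDegree_ramificationPoly_le (hij : i ≠ j) (p : MvPolynomial (Fin 2) k) :
    (ramificationPoly i p).natDegree ≤ 2 * p.degreeOf j * p.degreeOf i := by
  have hcoeff := natDegree_coeff_toBivariate_le hij p
  have hderiv : ∀ n, ((toBivariate i p).derivative.coeff n).natDegree ≤ p.degreeOf i := fun n => by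
    rw [Polynomial.coeff_derivative, ← Nat.cast_succ, mul_comm, ← nsmul_eq_mul]
    exact (Polynomial.natDegree_smul_le _ _).trans (hcoeff _)
  refine (natDegree_resultant_le hcoeff hderiv _ _).trans (Nat.mul_le_mul_right _ ?_)
  rw [two_mul, ← natDegree_toBivariate hij]
  exact Nat.add_le_add_left ((Polynomial.natDegree_derivative_le _).trans (Nat.sub_le _ _)) _

lemma separable_fibrePoly (hij : i ≠ j) (hj : 0 < p.degreeOf j) {a : k}
    (ha : (ramificationPoly i p).eval a ≠ 0) : (fibrePoly i ![1, a] p).Separable := by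
  rw [← map_toBivariate hij]
  have hdeg : (toBivariate i p).natDegree ≠ 0 := by rw [natDegree_toBivariate hij]; exact hj.ne'
  exact separable_map_of_map_resultant_ne_zero _ hdeg ha

end Ramification

section Orbits

variable {k : Type*} [Field k] {i j : Fin 2} {p : MvPolynomial (Fin 2) k} {O O' : Set (curve p)}

lemma degreeOf_pos_of_notMem_supported (hij : i ≠ j) (hp : p ∉ MvPolynomial.supported k {i}) :
    0 < p.degreeOf j := by
  contrapose! hp
  rw [MvPolynomial.mem_supported]
  intro l hl
  by_contra hli
  obtain rfl : l = j := by rw [Set.mem_singleton_iff] at hli; omega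
  exact MvPolynomial.mem_vars_iff_degreeOf_ne_zero.1 hl (Nat.le_zero.1 hp)

lemma mem_of_coordinate_eq (hO : O ∈ (orbitSetoid p).classes) {x y : curve p} (hx : x ∈ O)
    (h : coordinate i x = coordinate i y) : y ∈ O := by
  obtain ⟨z, rfl⟩ := hO
  have hyx : orbitSetoid p y x := by
    refine Relation.EqvGen.rel _ _ ?_
    obtain rfl | rfl : i = 0 ∨ i = 1 := by omega
    exacts [.inl h.symm, .inr h.symm]
  exact (orbitSetoid p).trans hyx hx

lemma eq_of_mem_of_coordinate_eq (hO : O ∈ (orbitSetoid p).classes)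
    (hO' : O' ∈ (orbitSetoid p).classes) {x y : curve p} (hx : x ∈ O) (hy : y ∈ O')
    (h : coordinate i x = coordinate i y) : O = O' :=
  Setoid.eq_of_mem_classes hO (mem_of_coordinate_eq hO hx h) hO' hy

lemma finite_and_ncard_orbits_meeting_le (p : MvPolynomial (Fin 2) k) (i : Fin 2)
    (S : Finset (P1 k)) :
    {O ∈ (orbitSetoid p).classes | ∃ x ∈ O, coordinate i x ∈ S}.Finite ∧
      {O ∈ (orbitSetoid p).classes | ∃ x ∈ O, coordinate i x ∈ S}.ncard ≤ S.card := by
  set E := {O ∈ (orbitSetoid p).classes | ∃ x ∈ O, coordinate i x ∈ S}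
  have hex : ∀ O : E, ∃ z : S, ∃ x ∈ O.1, coordinate i x = z := fun ⟨O, _, x, hx, hxS⟩ =>
    ⟨⟨_, hxS⟩, x, hx, rfl⟩
  choose value point hpoint hvalue using hex
  have hinj : Function.Injective value := fun O O' h =>
    Subtype.ext (eq_of_mem_of_coordinate_eq O.2.1 O'.2.1 (hpoint O) (hpoint O')
      (by rw [hvalue, hvalue, h]))
  exact ⟨Finite.of_injective value hinj, by simpa using Nat.card_le_card_of_injective value hinj⟩

open scoped Classical in
/-- The values of the coordinate `i` that are infinite or zeros of the ramification polynomial. -/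
def exceptionalValues (i : Fin 2) (p : MvPolynomial (Fin 2) k) : Finset (P1 k) :=
  insert (infinitePoint k) ((ramificationPoly i p).roots.toFinset.image affinePoint)

lemma card_exceptionalValues_le (hij : i ≠ j) (p : MvPolynomial (Fin 2) k) :
    (exceptionalValues i p).card ≤ 2 * p.degreeOf j * p.degreeOf i + 1 := by
  classical
  refine (Finset.card_insert_le _ _).trans (Nat.add_le_add_right ?_ 1)
  refine Finset.card_image_le.trans ((Multiset.toFinset_card_le _).trans ?_)
  exact (Polynomial.card_roots' _).trans (natDegree_ramificationPoly_le hij p)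

lemma infinitePoint_mem_exceptionalValues (i : Fin 2) (p : MvPolynomial (Fin 2) k) :
    infinitePoint k ∈ exceptionalValues i p := by
  classical exact Finset.mem_insert_self _ _

lemma eval_ramificationPoly_ne_zero [CharZero k] (hij : i ≠ j) (hirr : Irreducible p)
    (hj : 0 < p.degreeOf j) {a : k} (ha : affinePoint a ∉ exceptionalValues i p) :
    (ramificationPoly i p).eval a ≠ 0 := fun h => by
  classical
  exact ha (Finset.mem_insert_of_mem (Finset.mem_image_of_mem _ (Multiset.mem_toFinset.2
    ((Polynomial.mem_roots (ramificationPoly_ne_zero hij hirr hj)).2 h))))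

lemma dvd_rootPoly_of_separable [IsAlgClosed k] {f : Polynomial k} {B : Finset k}
    (hf : f.Separable) (hB : ∀ b, f.eval b = 0 → b ∈ B) : f ∣ rootPoly B := by
  refine (IsAlgClosed.splits f).dvd_of_roots_le_roots hf.ne_zero ?_
  rw [rootPoly, Polynomial.roots_prod_X_sub_C,
    Multiset.le_iff_subset (Polynomial.nodup_roots hf)]
  exact fun b hb => hB b (Polynomial.isRoot_of_mem_roots hb)

lemma isUnramifiedPair_of_orbit [IsAlgClosed k] [CharZero k] (hirr : Irreducible p)
    (hp : ∀ l, 0 < p.degreeOf l) (hO : O ∈ (orbitSetoid p).classes)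
    (hgood : ∀ x ∈ O, ∀ i, coordinate i x ∉ exceptionalValues i p) {A : Fin 2 → Finset k}
    (hA : ∀ i a, a ∈ A i ↔ ∃ x ∈ O, coordinate i x = affinePoint a) : IsUnramifiedPair p A := by
  intro i j hij a ha
  obtain ⟨x, hx, hxa⟩ := (hA i a).1 ha
  have horbit : ∀ y : curve p, coordinate i y = affinePoint a → y ∈ O := fun y hya =>
    mem_of_coordinate_eq hO hx (hxa.trans hya.symm)
  refine ⟨(natDegree_fibrePoly_le hij _ p).antisymm (Polynomial.le_natDegree_of_ne_zero ?_), ?_⟩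
  · intro hcoeff
    obtain ⟨y, hya, hy⟩ := exists_coordinate_eq_infinitePoint hij (by simp) hcoeff
    exact hgood y (horbit y hya) j (hy ▸ infinitePoint_mem_exceptionalValues j p)
  · have hram := eval_ramificationPoly_ne_zero hij hirr (hp j) (hxa ▸ hgood x hx i)
    refine dvd_rootPoly_of_separable (separable_fibrePoly hij (hp j) hram) fun b hb => ?_
    obtain ⟨y, hya, hyb⟩ := exists_coordinate_eq_affinePoint hij (by simp) hb
    exact (hA j b).2 ⟨y, horbit y hya, hyb⟩

lemma exists_isUnramifiedPair [IsAlgClosed k] [CharZero k] (hirr : Irreducible p)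
    (hp : ∀ l, 0 < p.degreeOf l) (hO : O ∈ finiteOrbits p)
    (hgood : ∀ x ∈ O, ∀ i, coordinate i x ∉ exceptionalValues i p) :
    ∃ A : Fin 2 → Finset k, IsUnramifiedPair p A ∧ (A 0).Nonempty ∧
      ∀ i a, a ∈ A i ↔ ∃ x ∈ O, coordinate i x = affinePoint a := by
  have hfin : ∀ i, (affinePoint ⁻¹' (coordinate i '' O) : Set k).Finite := fun i =>
    (hO.2.image _).preimage affinePoint_injective.injOn
  have hA : ∀ i a, a ∈ (hfin i).toFinset ↔ ∃ x ∈ O, coordinate i x = affinePoint a := by simp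
  refine ⟨_, isUnramifiedPair_of_orbit hirr hp hO.1 hgood hA, ?_, hA⟩
  obtain ⟨x, hx⟩ := Setoid.nonempty_of_mem_partition (orbitSetoid p).isPartition_classes hO.1
  obtain ⟨a, ha⟩ | hinf := eq_affinePoint_or_eq_infinitePoint (coordinate 0 x)
  · exact ⟨a, (hA 0 a).2 ⟨x, hx, ha⟩⟩
  · exact absurd (hinf ▸ infinitePoint_mem_exceptionalValues 0 p) (hgood x hx 0)

lemma subsingleton_unexceptional_finiteOrbits [IsAlgClosed k] [CharZero k] (hirr : Irreducible p)
    (hp : ∀ l, 0 < p.degreeOf l) (hinf : ¬ IsFiniteCorrespondence p) :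
    {O ∈ finiteOrbits p |
      ∀ x ∈ O, ∀ i, coordinate i x ∉ exceptionalValues i p}.Subsingleton := by
  rintro O ⟨hO, hgood⟩ O' ⟨hO', hgood'⟩
  by_contra hne
  obtain ⟨A, hA, hA0, hmemA⟩ := exists_isUnramifiedPair hirr hp hO hgood
  obtain ⟨B, hB, hB0, hmemB⟩ := exists_isUnramifiedPair hirr hp hO' hgood'
  refine hinf (isFiniteCorrespondence_of_isUnramifiedPair hirr hp hA hB hA0 hB0 fun i =>
    Finset.disjoint_left.2 fun a ha hb => ?_)
  obtain ⟨x, hx, hxa⟩ := (hmemA i a).1 ha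
  obtain ⟨y, hy, hya⟩ := (hmemB i a).1 hb
  exact hne (eq_of_mem_of_coordinate_eq hO.1 hO'.1 hx hy (hxa.trans hya.symm))

theorem finiteOrbits_finite_and_ncard_le [IsAlgClosed k] [CharZero k] (hirr : Irreducible p)
    (hp : ∀ l, 0 < p.degreeOf l) (hinf : ¬ IsFiniteCorrespondence p) :
    (finiteOrbits p).Finite ∧
      (finiteOrbits p).ncard ≤ 2 * (2 * p.degreeOf 0 * p.degreeOf 1 + 1) + 1 := by
  let E (i : Fin 2) : Set (Set (curve p)) :=
    {O ∈ (orbitSetoid p).classes | ∃ x ∈ O, coordinate i x ∈ exceptionalValues i p}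
  let G : Set (Set (curve p)) :=
    {O ∈ finiteOrbits p | ∀ x ∈ O, ∀ i, coordinate i x ∉ exceptionalValues i p}
  have hcover : finiteOrbits p ⊆ E 0 ∪ E 1 ∪ G := fun O hO => by
    by_cases h : ∀ x ∈ O, ∀ i, coordinate i x ∉ exceptionalValues i p
    · exact .inr ⟨hO, h⟩
    · push Not at h
      obtain ⟨x, hx, i, hi⟩ := h
      obtain rfl | rfl : i = 0 ∨ i = 1 := by omega
      exacts [.inl (.inl ⟨hO.1, x, hx, hi⟩), .inl (.inr ⟨hO.1, x, hx, hi⟩)]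
  have hG : G.Subsingleton := subsingleton_unexceptional_finiteOrbits hirr hp hinf
  obtain ⟨hE0, hcard0⟩ := finite_and_ncard_orbits_meeting_le p 0 (exceptionalValues 0 p)
  obtain ⟨hE1, hcard1⟩ := finite_and_ncard_orbits_meeting_le p 1 (exceptionalValues 1 p)
  have hfin : (E 0 ∪ E 1 ∪ G).Finite := (hE0.union hE1).union hG.finite
  refine ⟨hfin.subset hcover, (Set.ncard_le_ncard hcover hfin).trans ?_⟩
  calc (E 0 ∪ E 1 ∪ G).ncard ≤ (E 0).ncard + (E 1).ncard + G.ncard :=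
        (Set.ncard_union_le _ _).trans (Nat.add_le_add_right (Set.ncard_union_le _ _) _)
    _ ≤ (2 * p.degreeOf 1 * p.degreeOf 0 + 1) + (2 * p.degreeOf 0 * p.degreeOf 1 + 1) + 1 :=
        add_le_add (add_le_add (hcard0.trans (card_exceptionalValues_le zero_ne_one p))
          (hcard1.trans (card_exceptionalValues_le one_ne_zero p)))
          ((Set.ncard_le_one hG.finite).2 hG)
    _ = 2 * (2 * p.degreeOf 0 * p.degreeOf 1 + 1) + 1 := by ring

end Orbits

end PlaneCorrespondence

end

theorem theorem3p2_general {k : Type*} [Field k] [IsAlgClosed k] [CharZero k]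
    {p : MvPolynomial (Fin 2) k} (hirr : Irreducible p)
    (h0 : p ∉ MvPolynomial.supported k ({0} : Set (Fin 2)))
    (h1 : p ∉ MvPolynomial.supported k ({1} : Set (Fin 2)))
    (hinf : ¬ PlaneCorrespondence.IsFiniteCorrespondence p) :
    (PlaneCorrespondence.finiteOrbits p).Finite ∧
      (PlaneCorrespondence.finiteOrbits p).ncard ≤
        2 * (2 * p.totalDegree * p.totalDegree + 1) + 1 := by
  have hp : ∀ l, 0 < p.degreeOf l := Fin.forall_fin_two.2
    ⟨PlaneCorrespondence.degreeOf_pos_of_notMem_supported one_ne_zero h1,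
      PlaneCorrespondence.degreeOf_pos_of_notMem_supported zero_ne_one h0⟩
  refine (PlaneCorrespondence.finiteOrbits_finite_and_ncard_le hirr hp hinf).imp_right
    fun hcard => hcard.trans ?_
  gcongr <;> exact MvPolynomial.degreeOf_le_totalDegree p _

theorem theorem3p2 :
    ∃ B : ℕ → ℕ,
      ∀ (k : Type*) [Field k] [IsAlgClosed k] [CharZero k] (p : MvPolynomial (Fin 2) k),
        Irreducible p →
        p ∉ MvPolynomial.supported k ({0} : Set (Fin 2)) →
        p ∉ MvPolynomial.supported k ({1} : Set (Fin 2)) →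
        PlaneCorrespondence.IsNormalCurve p →
        ¬ PlaneCorrespondence.IsFiniteCorrespondence p →
        (PlaneCorrespondence.finiteOrbits p).Finite ∧
          (PlaneCorrespondence.finiteOrbits p).ncard ≤ B p.totalDegree :=
  ⟨fun d => 2 * (2 * d * d + 1) + 1, fun _ _ _ _ _ hirr h0 h1 _ hinf =>
    theorem3p2_general hirr h0 h1 hinf⟩
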